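/- Let $\mu,\kappa,\alpha,\beta,\gamma,\tau,\lambda,\nu$ be real constants with $\mu>0$, $\kappa>0$, $\tilde\alpha:=\alpha+\tfrac{4\beta}{3}>0$, $\tilde\gamma:=\beta+\gamma>0$, $\tau>0$ and $\lambda>\nu>0$. Put $J_{eq}=\operatorname{diag}(\lambda,\lambda,\nu)$ and $s=-\frac{1}{\sqrt{\lambda-\nu}}\frac{\tau}{2\kappa}$. For $k\in\mathbb{R}^3$ with Euclidean norm $|k|$ let $P_\parallel(k)=\frac{k\otimes k}{|k|^2}$ if $k\ne0$, $P_\parallel(0)=0$, $P_\perp(k)=I-P_\parallel(k)$, let $k\times$ denote the matrix of $z\mapsto k\times z$, and let $T(k)=\frac{i\,k\times}{|k|}$ if $k\neq 0$, $T(0)=0$. Let $$R_{22}=\begin{pmatrix}0&-1\\1&0\end{pmatrix},\quad R_{23}=\begin{pmatrix}0&-1&0\\1&0&0\end{pmatrix},\quad R_{32}=\begin{pmatrix}0&-1\\1&0\\0&0\end{pmatrix},\quad R_{33}=\begin{pmatrix}0&-1&0\\1&0&0\\0&0&0\end{pmatrix}.$$ Define the $8\times 8$ matrices (in blocks of sizes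 $3,3,2$) $$\hat{\mathcal B}_k=\begin{pmatrix}-(\mu+\frac\kappa2)|k|^2P_\perp(k)& i\kappa\, k\times&0\\ J_{eq}^{-1}(i\kappa\, k\times)P_\perp(k)&-2\kappa J_{eq}^{-1}-\tilde\alpha|k|^2J_{eq}^{-1}P_\parallel(k)-\tilde\gamma|k|^2J_{eq}^{-1}P_\perp(k)-(1-\frac\nu\lambda)\frac{\tau}{2\kappa}R_{33}&-\frac1\lambda\left(\frac{\tau}{2\kappa}\right)^2R_{32}\\0&(\lambda-\nu)R_{23}&\frac{\tau}{2\kappa}R_{22}\end{pmatrix},$$ $$Q_k=T(k)\oplus J_{eq}^{1/2}\oplus sR_{22},\qquad \bar Q_k=T(k)\oplus J_{eq}^{-1/2}\oplus(-s^{-1})R_{22},\qquad M(k)=Q_k\,\hat{\mathcal B}_k\,\bar Q_k .$$ ($\hat{\mathcal B}_k$ is the Fourier symbol, on the torus, of the nontrivial block of the linearized equations of an anisotropic micropolar fluid about the equilibrium with angular velocity $\frac{\tau}{2\kappa}e_3$ and microinertia $J_{eq}$.) Then there exist $k_*\in\mathbb{Z}^3$ and $w_*\in\mathbb{C}$ with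 $\operatorname{Re}w_*>0$ such that 1. $w_*$ is an eigenvalue of $M(k_*)$, and 2. for every $k\in\mathbb{Z}^3$ and every (complex) eigenvalue $w$ of $M(k)$, $\operatorname{Re}w\le\operatorname{Re}w_*$. The maximal growth rate is then defined as $\eta_*:=\operatorname{Re}w_*$. -/

import Mathlib

namespace Micropolar

noncomputable section

/-- The physical constants: viscosities `μ, κ, α, β, γ`, magnitude `τ` of the microtorque, and the
eigenvalues `lam, lam, ν` of the microinertia. -/
structure Params where
  μ : ℝ
  κ : ℝ
  α : ℝ
  β : ℝ
  γ : ℝ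
  τ : ℝ
  lam : ℝ
  ν : ℝ

/-- The constants of an inertially oblong micropolar fluid driven by a constant microtorque. -/
structure Params.Oblong (p : Params) : Prop where
  μ_pos : 0 < p.μ
  κ_pos : 0 < p.κ
  αt_pos : 0 < p.α + 4 * p.β / 3
  γt_pos : 0 < p.β + p.γ
  τ_pos : 0 < p.τ
  ν_pos : 0 < p.ν
  ν_lt_lam : p.ν < p.lam

/-- `α̃ = α + 4β/3`. -/
def Params.αt (p : Params) : ℝ := p.α + 4 * p.β / 3

/-- `γ̃ = β + γ`. -/
def Params.γt (p : Params) : ℝ := p.β + p.γ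

/-- `τ / (2κ)`. -/
def Params.d (p : Params) : ℝ := p.τ / (2 * p.κ)

/-- `J_eq ^ r` for `J_eq = diag (λ, λ, ν)` and a real exponent `r`. -/
def Params.JeqPow (p : Params) (r : ℝ) : Matrix (Fin 3) (Fin 3) ℝ :=
  Matrix.diagonal ![p.lam ^ r, p.lam ^ r, p.ν ^ r]

/-- `s = - (λ - ν)^{-1/2} τ / (2κ)`. -/
def Params.s (p : Params) : ℝ := -1 / Real.sqrt (p.lam - p.ν) * p.d

/-- Wavenumbers, with the Euclidean norm. -/
abbrev Wave : Type := EuclideanSpace ℝ (Fin 3)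

/-- Orthogonal projection onto the span of `k`: `k ⊗ k / |k|²`, and `0` when `k = 0`. -/
def Ppar (k : Wave) : Matrix (Fin 3) (Fin 3) ℝ :=
  Matrix.of fun i j => k i * k j / ‖k‖ ^ 2

/-- Orthogonal projection onto the orthogonal complement of the span of `k`. -/
def Pperp (k : Wave) : Matrix (Fin 3) (Fin 3) ℝ := 1 - Ppar k

/-- The matrix of the linear map `z ↦ k × z`. -/
def cross (k : Wave) : Matrix (Fin 3) (Fin 3) ℝ :=
  !![0, -k 2, k 1;
     k 2, 0, -k 0;
     -k 1, k 0, 0]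

def R22 : Matrix (Fin 2) (Fin 2) ℝ := !![0, -1; 1, 0]

def R23 : Matrix (Fin 2) (Fin 3) ℝ := !![0, -1, 0; 1, 0, 0]

def R32 : Matrix (Fin 3) (Fin 2) ℝ := !![0, -1; 1, 0; 0, 0]

def R33 : Matrix (Fin 3) (Fin 3) ℝ := !![0, -1, 0; 1, 0, 0; 0, 0, 0]

/-- The eight indices, grouped as `ℂ⁸ = ℂ³ × ℂ³ × ℂ²`. -/
abbrev Idx : Type := Fin 3 ⊕ (Fin 3 ⊕ Fin 2)

/-- A real matrix, read as a complex one. -/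
def toC {m n : Type} (A : Matrix m n ℝ) : Matrix m n ℂ := A.map Complex.ofReal

/-- The 8-by-8 matrix with the given rows of blocks. -/
def blocks (A₁₁ A₁₂ : Matrix (Fin 3) (Fin 3) ℂ) (A₁₃ : Matrix (Fin 3) (Fin 2) ℂ)
    (A₂₁ A₂₂ : Matrix (Fin 3) (Fin 3) ℂ) (A₂₃ : Matrix (Fin 3) (Fin 2) ℂ)
    (A₃₁ A₃₂ : Matrix (Fin 2) (Fin 3) ℂ) (A₃₃ : Matrix (Fin 2) (Fin 2) ℂ) :
    Matrix Idx Idx ℂ :=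
  Matrix.fromBlocks A₁₁ (Matrix.fromCols A₁₂ A₁₃) (Matrix.fromRows A₂₁ A₃₁)
    (Matrix.fromBlocks A₂₂ A₂₃ A₃₂ A₃₃)

/-- `A ⊕ B ⊕ C`. -/
def directSum (A B : Matrix (Fin 3) (Fin 3) ℂ) (C : Matrix (Fin 2) (Fin 2) ℂ) :
    Matrix Idx Idx ℂ :=
  blocks A 0 0 0 B 0 0 0 C

/-- The symbol at wavenumber `k` of the Leray-projected linearization about the equilibrium
`(u, ω, J) = (0, τ / (2κ) e₃, diag (λ, λ, ν))`, in the unknowns `(u, ω, a)` with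
`a = (J₁₃, J₂₃)`. -/
def Bhat (p : Params) (k : Wave) : Matrix Idx Idx ℂ :=
  blocks
    (toC (-((p.μ + p.κ / 2) * ‖k‖ ^ 2) • Pperp k))
    ((Complex.I * p.κ) • toC (cross k))
    0
    (toC (p.JeqPow (-1)) * ((Complex.I * p.κ) • toC (cross k)) * toC (Pperp k))
    (toC (-(2 * p.κ) • p.JeqPow (-1)
      - (p.αt * ‖k‖ ^ 2) • (p.JeqPow (-1) * Ppar k)
      - (p.γt * ‖k‖ ^ 2) • (p.JeqPow (-1) * Pperp k)
      - ((1 - p.ν / p.lam) * p.d) • R33))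
    (toC (-(1 / p.lam * p.d ^ 2) • R32))
    0
    (toC ((p.lam - p.ν) • R23))
    (toC (p.d • R22))

/-- `T(k) = i k× / |k|`, and `0` when `k = 0`. -/
def T (k : Wave) : Matrix (Fin 3) (Fin 3) ℂ := (Complex.I / (‖k‖ : ℂ)) • toC (cross k)

/-- `Q_k = T(k) ⊕ J_eq^{1/2} ⊕ s R₂₂`. -/
def Q (p : Params) (k : Wave) : Matrix Idx Idx ℂ :=
  directSum (T k) (toC (p.JeqPow (1 / 2))) (toC (p.s • R22))

/-- `Q̄_k = T(k) ⊕ J_eq^{-1/2} ⊕ (-s⁻¹) R₂₂`. -/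
def Qbar (p : Params) (k : Wave) : Matrix Idx Idx ℂ :=
  directSum (T k) (toC (p.JeqPow (-1 / 2))) (toC ((-p.s⁻¹) • R22))

/-- `M_k = Q_k B̂_k Q̄_k`. -/
def M (p : Params) (k : Wave) : Matrix Idx Idx ℂ := Q p k * Bhat p k * Qbar p k

/-- A point of `ℤ³`, as a wavenumber. -/
def latt (k : Fin 3 → ℤ) : Wave := WithLp.toLp 2 fun i => (k i : ℝ)

/-- `w` is an eigenvalue of the matrix `A`. -/
def IsEigenvalue (A : Matrix Idx Idx ℂ) (w : ℂ) : Prop :=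
  Module.End.HasEigenvalue (Matrix.toLin' A) w

end

end Micropolar

namespace Micropolar

open Matrix

noncomputable section

/-! The growth rates are bounded above by a constant over `‖k‖ ^ 2` for `k ≠ 0`, and some mode
grows; so only finitely many pairs (mode, eigenvalue) compete and a maximum exists. Decay: `M p k`
is a real matrix (`M_eq_toC_Mreal`) in which velocity and microinertia both couple symmetrically to
angular velocity, while the rotations are antisymmetric and vanish from the quadratic form.
Dissipation absorbs the velocity coupling, and rotational viscosity of size `‖k‖ ^ 2` absorbs the
microinertia coupling up to an error of order `‖k‖⁻²` (`dotProduct_Mreal_le`). Growth: at `k = 0`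
circularly polarized vectors reduce the problem to a complex quadratic with a root in the right
half-plane (`exists_unstable_root`). -/

/-! ### Block algebra and the cross product -/

theorem toC_mul {l m n : Type} [Fintype m] (A : Matrix l m ℝ) (B : Matrix m n ℝ) :
    toC (A * B) = toC A * toC B := by
  ext i j
  simp [toC, Matrix.mul_apply]

theorem toC_smul {m n : Type} (r : ℝ) (A : Matrix m n ℝ) :
    toC (r • A) = (r : ℂ) • toC A := by
  ext i j
  simp [toC]

theorem directSum_mul_blocks_mul_directSum (A B : Matrix (Fin 3) (Fin 3) ℂ)
    (C : Matrix (Fin 2) (Fin 2) ℂ) (A' B' : Matrix (Fin 3) (Fin 3) ℂ)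
    (C' : Matrix (Fin 2) (Fin 2) ℂ)
    (A₁₁ A₁₂ : Matrix (Fin 3) (Fin 3) ℂ) (A₁₃ : Matrix (Fin 3) (Fin 2) ℂ)
    (A₂₁ A₂₂ : Matrix (Fin 3) (Fin 3) ℂ) (A₂₃ : Matrix (Fin 3) (Fin 2) ℂ)
    (A₃₁ A₃₂ : Matrix (Fin 2) (Fin 3) ℂ) (A₃₃ : Matrix (Fin 2) (Fin 2) ℂ) :
    directSum A B C * blocks A₁₁ A₁₂ A₁₃ A₂₁ A₂₂ A₂₃ A₃₁ A₃₂ A₃₃ * directSum A' B' C' =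
      blocks (A * A₁₁ * A') (A * A₁₂ * B') (A * A₁₃ * C')
        (B * A₂₁ * A') (B * A₂₂ * B') (B * A₂₃ * C')
        (C * A₃₁ * A') (C * A₃₂ * B') (C * A₃₃ * C') := by
  ext (i | i | i) (j | j | j) <;>
    simp [directSum, blocks, Matrix.mul_apply, Fintype.sum_sum_type]

theorem norm_sq_eq_coords (k : Wave) : ‖k‖ ^ 2 = k 0 ^ 2 + k 1 ^ 2 + k 2 ^ 2 := by
  simp [EuclideanSpace.real_norm_sq_eq, Fin.sum_univ_three]

theorem cross_mul_Ppar (k : Wave) : cross k * Ppar k = 0 := by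
  ext i j
  fin_cases i <;> simp [Ppar, cross, Matrix.mul_apply, Fin.sum_univ_three] <;> ring

theorem cross_mul_Pperp (k : Wave) : cross k * Pperp k = cross k := by
  simp [Pperp, mul_sub, cross_mul_Ppar]

theorem cross_mul_cross (k : Wave) : cross k * cross k = (-‖k‖ ^ 2) • Pperp k := by
  by_cases hk : k = 0
  · subst hk
    ext i j
    fin_cases i <;> fin_cases j <;> simp [cross, Matrix.mul_apply, Fin.sum_univ_three]
  have hK : ‖k‖ ^ 2 ≠ 0 := by simpa using hk
  have hP : ‖k‖ ^ 2 • Ppar k = Matrix.of fun i j => k i * k j := by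
    ext i j
    simp only [Ppar, Matrix.smul_apply, Matrix.of_apply, smul_eq_mul]
    field_simp
  rw [Pperp, smul_sub, neg_smul, neg_smul, hP, norm_sq_eq_coords]
  ext i j
  fin_cases i <;> fin_cases j <;> simp [cross, Matrix.mul_apply, Fin.sum_univ_three] <;> ring

/-! ### Reduction to a real matrix -/

/-- The coupling constant `τ / (2κ) * √(1 - ν / λ)` between angular velocity and microinertia. -/
def Params.coupling (p : Params) : ℝ := p.d * Real.sqrt (p.lam - p.ν) * p.lam ^ (-1 / 2 : ℝ)

/-- The inclusion of `ℝ²` into `ℝ³` as the first two coordinates. -/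
def I32 : Matrix (Fin 3) (Fin 2) ℝ := !![1, 0; 0, 1; 0, 0]

/-- The real matrix whose complexification is `M p k`. -/
def Mreal (p : Params) (k : Wave) : Matrix Idx Idx ℝ :=
  Matrix.fromBlocks (-((p.μ + p.κ / 2) * ‖k‖ ^ 2) • Pperp k)
    (Matrix.fromCols ((p.κ * ‖k‖) • (Pperp k * p.JeqPow (-1 / 2))) 0)
    (Matrix.fromRows ((p.κ * ‖k‖) • (p.JeqPow (-1 / 2) * Pperp k)) 0)
    (Matrix.fromBlocks
      (p.JeqPow (-1 / 2) * (-(2 * p.κ) • 1 - (p.αt * ‖k‖ ^ 2) • Ppar k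
        - (p.γt * ‖k‖ ^ 2) • Pperp k) * p.JeqPow (-1 / 2) - ((1 - p.ν / p.lam) * p.d) • R33)
      (p.coupling • I32) (p.coupling • I32ᵀ) (p.d • R22))

theorem JeqPow_mul_JeqPow {p : Params} (hp : p.Oblong) (a b : ℝ) :
    p.JeqPow a * p.JeqPow b = p.JeqPow (a + b) := by
  have hl : 0 < p.lam := hp.ν_pos.trans hp.ν_lt_lam
  simp only [Params.JeqPow, Matrix.diagonal_mul_diagonal]
  congr 1
  ext i
  fin_cases i <;> simp [Real.rpow_add hl, Real.rpow_add hp.ν_pos]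

/-- `R33` acts only in the plane where the microinertia is a scalar, so the two powers cancel. -/
theorem JeqPow_mul_R33_mul {p : Params} (hp : p.Oblong) :
    p.JeqPow (1 / 2) * R33 * p.JeqPow (-1 / 2) = R33 := by
  have hl : 0 < p.lam := hp.ν_pos.trans hp.ν_lt_lam
  have h : p.lam ^ (1 / 2 : ℝ) * p.lam ^ (-1 / 2 : ℝ) = 1 := by
    rw [← Real.rpow_add hl]; norm_num
  rw [Params.JeqPow, Params.JeqPow]
  ext i j
  rw [Matrix.mul_diagonal, Matrix.diagonal_mul]
  fin_cases i <;> fin_cases j <;> simp [R33] <;> simpa using h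

theorem d_pos {p : Params} (hp : p.Oblong) : 0 < p.d :=
  div_pos hp.τ_pos (mul_pos two_pos hp.κ_pos)

theorem lam_pos {p : Params} (hp : p.Oblong) : 0 < p.lam := hp.ν_pos.trans hp.ν_lt_lam

/-- `T k` squares to `Pperp k` only for `k ≠ 0`; the factor `‖k‖ ^ 2` makes the identity survive at
`k = 0`, where `T` vanishes but `Pperp` is the identity. -/
theorem T_mul_Pperp_mul_T (r : ℝ) (k : Wave) :
    T k * toC ((r * ‖k‖ ^ 2) • Pperp k) * T k = toC ((r * ‖k‖ ^ 2) • Pperp k) := by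
  simp only [T, toC_smul, Matrix.smul_mul, Matrix.mul_smul]
  rw [← toC_mul, ← toC_mul, cross_mul_Pperp, cross_mul_cross, toC_smul]
  simp only [smul_smul]
  congr 1
  by_cases hk : (‖k‖ : ℂ) = 0
  · simp [hk]
  push_cast
  field_simp
  simp

theorem T_mul_cross (r : ℝ) (k : Wave) :
    T k * ((Complex.I * r) • toC (cross k)) = toC ((r * ‖k‖) • Pperp k) := by
  rw [T, Matrix.smul_mul, Matrix.mul_smul, ← toC_mul, cross_mul_cross, toC_smul, toC_smul]
  simp only [smul_smul]
  congr 1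
  by_cases hk : (‖k‖ : ℂ) = 0
  · simp [hk]
  push_cast
  field_simp
  simp

theorem cross_mul_T (r : ℝ) (k : Wave) :
    ((Complex.I * r) • toC (cross k)) * T k = toC ((r * ‖k‖) • Pperp k) := by
  rw [← T_mul_cross, T]
  simp only [Matrix.smul_mul, Matrix.mul_smul]
  rw [smul_comm]

theorem s_ne_zero {p : Params} (hp : p.Oblong) : p.s ≠ 0 := by
  have h : 0 < Real.sqrt (p.lam - p.ν) := Real.sqrt_pos.2 (sub_pos.2 hp.ν_lt_lam)
  exact mul_ne_zero (div_ne_zero (by norm_num) h.ne') (d_pos hp).ne'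

/-- The value of `p.s` balances the two blocks joining angular velocity and microinertia: both
acquire the factor `p.coupling` and become mutual transposes. The factors `T k` turn the imaginary
cross products into real projections. -/
theorem M_eq_toC_Mreal {p : Params} (hp : p.Oblong) (k : Wave) : M p k = toC (Mreal p k) := by
  have hl := lam_pos hp
  have hs := s_ne_zero hp
  have hd := d_pos hp
  have hr : 0 < Real.sqrt (p.lam - p.ν) := Real.sqrt_pos.2 (sub_pos.2 hp.ν_lt_lam)
  have hr2 : Real.sqrt (p.lam - p.ν) ^ 2 = p.lam - p.ν :=
    Real.sq_sqrt (sub_pos.2 hp.ν_lt_lam).le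
  have hJ : p.JeqPow (1 / 2) * p.JeqPow (-1) = p.JeqPow (-1 / 2) := by
    rw [JeqPow_mul_JeqPow hp]; norm_num
  have h11 : T k * toC (-((p.μ + p.κ / 2) * ‖k‖ ^ 2) • Pperp k) * T k =
      toC (-((p.μ + p.κ / 2) * ‖k‖ ^ 2) • Pperp k) := by
    simpa only [neg_mul] using T_mul_Pperp_mul_T (-(p.μ + p.κ / 2)) k
  have h12 : T k * ((Complex.I * p.κ) • toC (cross k)) * toC (p.JeqPow (-1 / 2)) =
      toC ((p.κ * ‖k‖) • (Pperp k * p.JeqPow (-1 / 2))) := by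
    rw [T_mul_cross, ← toC_mul, Matrix.smul_mul]
  have h21 : toC (p.JeqPow (1 / 2)) *
      (toC (p.JeqPow (-1)) * ((Complex.I * p.κ) • toC (cross k)) * toC (Pperp k)) * T k =
      toC ((p.κ * ‖k‖) • (p.JeqPow (-1 / 2) * Pperp k)) := by
    rw [Matrix.mul_assoc (toC (p.JeqPow (-1))), Matrix.smul_mul, ← toC_mul, cross_mul_Pperp,
      ← Matrix.mul_assoc, ← toC_mul, hJ, Matrix.mul_assoc, cross_mul_T, ← toC_mul,
      Matrix.mul_smul]
  have h22 : toC (p.JeqPow (1 / 2)) * toC (-(2 * p.κ) • p.JeqPow (-1)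
      - (p.αt * ‖k‖ ^ 2) • (p.JeqPow (-1) * Ppar k)
      - (p.γt * ‖k‖ ^ 2) • (p.JeqPow (-1) * Pperp k)
      - ((1 - p.ν / p.lam) * p.d) • R33) * toC (p.JeqPow (-1 / 2)) =
      toC (p.JeqPow (-1 / 2) * (-(2 * p.κ) • 1 - (p.αt * ‖k‖ ^ 2) • Ppar k
        - (p.γt * ‖k‖ ^ 2) • Pperp k) * p.JeqPow (-1 / 2) -
          ((1 - p.ν / p.lam) * p.d) • R33) := by
    rw [← toC_mul, ← toC_mul, Matrix.mul_sub, Matrix.sub_mul]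
    congr 2
    · congr 1
      simp only [Matrix.mul_sub, Matrix.mul_smul, ← Matrix.mul_assoc, hJ, Matrix.mul_one]
    · rw [Matrix.mul_smul, Matrix.smul_mul, JeqPow_mul_R33_mul hp]
  have h23 : toC (p.JeqPow (1 / 2)) * toC (-(1 / p.lam * p.d ^ 2) • R32) *
      toC ((-p.s⁻¹) • R22) = toC (p.coupling • I32) := by
    have hq : p.lam ^ (1 / 2 : ℝ) = p.lam * p.lam ^ (-1 / 2 : ℝ) := by
      nth_rewrite 2 [← Real.rpow_one p.lam]
      rw [← Real.rpow_add hl]; norm_num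
    have key : p.lam ^ (1 / 2 : ℝ) * (1 / p.lam * p.d ^ 2) * (-p.s⁻¹) = p.coupling := by
      rw [hq, Params.s, Params.coupling]
      field_simp
    rw [← toC_mul, ← toC_mul, Params.JeqPow]
    congr 1
    ext i j
    rw [← key]
    fin_cases i <;> fin_cases j <;>
      simp [R32, R22, I32, Matrix.mul_apply, Fin.sum_univ_succ, Matrix.diagonal_apply]
  have h32 : toC (p.s • R22) * toC ((p.lam - p.ν) • R23) * toC (p.JeqPow (-1 / 2)) =
      toC (p.coupling • I32ᵀ) := by
    have key : -p.s * (p.lam - p.ν) * p.lam ^ (-1 / 2 : ℝ) = p.coupling := by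
      rw [← hr2, Params.s, Params.coupling]
      field_simp
    rw [← toC_mul, ← toC_mul, Params.JeqPow]
    congr 1
    ext i j
    rw [← key, Matrix.mul_diagonal]
    fin_cases i <;> fin_cases j <;>
      simp [R23, R22, I32, Matrix.mul_apply, Fin.sum_univ_succ] <;> ring
  have h33 : toC (p.s • R22) * toC (p.d • R22) * toC ((-p.s⁻¹) • R22) = toC (p.d • R22) := by
    rw [← toC_mul, ← toC_mul]
    congr 1
    ext i j
    fin_cases i <;> fin_cases j <;>
      simp [R22, Matrix.mul_apply, Fin.sum_univ_succ, hs, mul_comm p.s]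
  rw [M, Q, Qbar, Bhat, directSum_mul_blocks_mul_directSum, h11, h12, h21, h22, h23, h32, h33]
  simp only [Matrix.mul_zero, Matrix.zero_mul]
  ext (i | i | i) (j | j | j) <;> simp [blocks, toC, Mreal]

/-! ### Eigenvalue bounds from the quadratic form -/

theorem IsEigenvalue.exists_mulVec {A : Matrix Idx Idx ℂ} {w : ℂ} (h : IsEigenvalue A w) :
    ∃ v : Idx → ℂ, v ≠ 0 ∧ A *ᵥ v = w • v := by
  obtain ⟨v, hv⟩ := Module.End.HasEigenvalue.exists_hasEigenvector h
  exact ⟨v, hv.2, by simpa using hv.apply_eq_smul⟩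

theorem IsEigenvalue.of_mulVec {A : Matrix Idx Idx ℂ} {w : ℂ} {v : Idx → ℂ} (hv : v ≠ 0)
    (h : A *ᵥ v = w • v) : IsEigenvalue A w :=
  Module.End.hasEigenvalue_of_hasEigenvector
    (Module.End.hasEigenvector_iff.2 ⟨Module.End.mem_eigenspace_iff.2 (by simpa using h), hv⟩)

/-- A bound on the quadratic form of a real matrix bounds the real parts of its eigenvalues. -/
theorem IsEigenvalue.re_le_of_forall_dotProduct_le {N : Matrix Idx Idx ℝ} {η : ℝ}
    (hN : ∀ x : Idx → ℝ, x ⬝ᵥ N *ᵥ x ≤ η * (x ⬝ᵥ x)) {w : ℂ} (hw : IsEigenvalue (toC N) w) :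
    w.re ≤ η := by
  obtain ⟨v, hv, h⟩ := hw.exists_mulVec
  set x : Idx → ℝ := fun i => (v i).re with hx
  set y : Idx → ℝ := fun i => (v i).im with hy
  have hre : N *ᵥ x = w.re • x - w.im • y := by
    ext i
    have := congrArg Complex.re (congrFun h i)
    simpa [Matrix.mulVec, dotProduct, toC, hx, hy] using this
  have him : N *ᵥ y = w.re • y + w.im • x := by
    ext i
    have := congrArg Complex.im (congrFun h i)
    simpa [Matrix.mulVec, dotProduct, toC, hx, hy] using this
  -- The terms in `w.im` cancel when the bounds for the real and imaginary parts of the eigenvector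
  -- are added.
  have h1 := hN x
  have h2 := hN y
  rw [hre, dotProduct_sub, dotProduct_smul, dotProduct_smul, smul_eq_mul, smul_eq_mul] at h1
  rw [him, dotProduct_add, dotProduct_smul, dotProduct_smul, smul_eq_mul, smul_eq_mul,
    dotProduct_comm y x] at h2
  have hx0 : 0 ≤ x ⬝ᵥ x := Finset.sum_nonneg fun i _ => mul_self_nonneg _
  have hy0 : 0 ≤ y ⬝ᵥ y := Finset.sum_nonneg fun i _ => mul_self_nonneg _
  have hpos : 0 < x ⬝ᵥ x + y ⬝ᵥ y := by
    refine lt_of_le_of_ne (add_nonneg hx0 hy0) fun h0 => hv ?_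
    have hx' : x = 0 := dotProduct_self_eq_zero.1 (by linarith)
    have hy' : y = 0 := dotProduct_self_eq_zero.1 (by linarith)
    ext i
    exact Complex.ext (congrFun hx' i) (congrFun hy' i)
  refine le_of_mul_le_mul_right ?_ hpos
  linarith

/-- The quadratic form of `Mreal p k`; its antisymmetric part drops out. -/
theorem dotProduct_Mreal_mulVec (p : Params) (k : Wave) (x : Idx → ℝ) (u o : Fin 3 → ℝ)
    (a : Fin 2 → ℝ) (z : Fin 3 → ℝ) (hx : x = Sum.elim u (Sum.elim o a))
    (hz : z = p.JeqPow (-1 / 2) *ᵥ o) :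
    x ⬝ᵥ Mreal p k *ᵥ x =
      -((p.μ + p.κ / 2) * ‖k‖ ^ 2) * (u ⬝ᵥ Pperp k *ᵥ u)
        + 2 * (p.κ * ‖k‖) * (u ⬝ᵥ Pperp k *ᵥ z) - 2 * p.κ * (z ⬝ᵥ z)
        - p.αt * ‖k‖ ^ 2 * (z ⬝ᵥ Ppar k *ᵥ z) - p.γt * ‖k‖ ^ 2 * (z ⬝ᵥ Pperp k *ᵥ z)
        + 2 * p.coupling * (o 0 * a 0 + o 1 * a 1) := by
  subst hx
  have hz0 : z 0 = p.lam ^ (-1 / 2 : ℝ) * o 0 := by simp [hz, Params.JeqPow, mulVec_diagonal]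
  have hz1 : z 1 = p.lam ^ (-1 / 2 : ℝ) * o 1 := by simp [hz, Params.JeqPow, mulVec_diagonal]
  have hz2 : z 2 = p.ν ^ (-1 / 2 : ℝ) * o 2 := by simp [hz, Params.JeqPow, mulVec_diagonal]
  simp [Mreal, Params.JeqPow, Matrix.mulVec, dotProduct, Fintype.sum_sum_type, Fin.sum_univ_three,
    Fin.sum_univ_two, Pperp, Ppar, I32, R33, R22, Matrix.mul_diagonal, Matrix.diagonal_mul,
    Matrix.one_apply, hz0, hz1, hz2]
  ring

theorem dotProduct_Ppar_add_Pperp (k : Wave) (x : Fin 3 → ℝ) :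
    x ⬝ᵥ Ppar k *ᵥ x + x ⬝ᵥ Pperp k *ᵥ x = x ⬝ᵥ x := by
  simp [Pperp, sub_mulVec, dotProduct_sub]

theorem dotProduct_Ppar_eq (k : Wave) (x : Fin 3 → ℝ) :
    x ⬝ᵥ Ppar k *ᵥ x = (k 0 * x 0 + k 1 * x 1 + k 2 * x 2) ^ 2 / ‖k‖ ^ 2 := by
  simp [Ppar, Matrix.mulVec, dotProduct, Fin.sum_univ_three]
  ring

theorem dotProduct_Ppar_nonneg (k : Wave) (x : Fin 3 → ℝ) : 0 ≤ x ⬝ᵥ Ppar k *ᵥ x := by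
  rw [dotProduct_Ppar_eq]
  positivity

theorem dotProduct_Pperp_nonneg (k : Wave) (x : Fin 3 → ℝ) : 0 ≤ x ⬝ᵥ Pperp k *ᵥ x := by
  suffices h : x ⬝ᵥ Ppar k *ᵥ x ≤ x ⬝ᵥ x by linarith [dotProduct_Ppar_add_Pperp k x]
  rw [dotProduct_Ppar_eq]
  refine div_le_of_le_mul₀ (by positivity)
    (Finset.sum_nonneg fun i _ => mul_self_nonneg _) ?_
  rw [norm_sq_eq_coords]
  simp only [dotProduct, Fin.sum_univ_three]
  nlinarith [sq_nonneg (k 0 * x 1 - k 1 * x 0), sq_nonneg (k 0 * x 2 - k 2 * x 0),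
    sq_nonneg (k 1 * x 2 - k 2 * x 1)]

theorem dotProduct_Pperp_comm (k : Wave) (x y : Fin 3 → ℝ) :
    x ⬝ᵥ Pperp k *ᵥ y = y ⬝ᵥ Pperp k *ᵥ x := by
  simp [Pperp, Ppar, Matrix.mulVec, dotProduct, Fin.sum_univ_three, Matrix.one_apply]
  ring

theorem dotProduct_Pperp_sub (k : Wave) (r t : ℝ) (x y : Fin 3 → ℝ) :
    (r • x - t • y) ⬝ᵥ Pperp k *ᵥ (r • x - t • y) =
      r ^ 2 * (x ⬝ᵥ Pperp k *ᵥ x) - 2 * (r * t) * (x ⬝ᵥ Pperp k *ᵥ y)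
        + t ^ 2 * (y ⬝ᵥ Pperp k *ᵥ y) := by
  simp only [mulVec_sub, mulVec_smul, dotProduct_sub, sub_dotProduct, dotProduct_smul,
    smul_dotProduct, smul_eq_mul]
  rw [dotProduct_Pperp_comm k y x]
  ring

theorem rpow_neg_half_sq {t : ℝ} (ht : 0 < t) : (t ^ (-1 / 2 : ℝ)) ^ 2 = t⁻¹ := by
  rw [sq, ← Real.rpow_add ht, ← Real.rpow_neg_one]
  norm_num

/-- Energy estimate: the viscous terms control everything but the microinertia. -/
theorem dotProduct_Mreal_le {p : Params} (hp : p.Oblong) {k : Wave} (hk : k ≠ 0)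
    (x : Idx → ℝ) :
    x ⬝ᵥ Mreal p k *ᵥ x ≤
      p.coupling ^ 2 * p.lam / (min p.αt p.γt * ‖k‖ ^ 2) * (x ⬝ᵥ x) := by
  have hl := lam_pos hp
  have hK : 0 < ‖k‖ := norm_pos_iff.2 hk
  set u : Fin 3 → ℝ := fun i => x (Sum.inl i) with hu
  set o : Fin 3 → ℝ := fun i => x (Sum.inr (Sum.inl i)) with ho
  set a : Fin 2 → ℝ := fun i => x (Sum.inr (Sum.inr i)) with ha
  have hx : x = Sum.elim u (Sum.elim o a) := by
    ext (i | i | i) <;> rfl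
  set z := p.JeqPow (-1 / 2) *ᵥ o with hz
  rw [dotProduct_Mreal_mulVec p k x u o a z hx hz]
  set m := min p.αt p.γt with hm
  have hm0 : 0 < m := lt_min hp.αt_pos hp.γt_pos
  set c := p.coupling
  have hsum := dotProduct_Ppar_add_Pperp k z
  have hpar := dotProduct_Ppar_nonneg k z
  have hperp := dotProduct_Pperp_nonneg k z
  have hstretch : m * ‖k‖ ^ 2 * (z ⬝ᵥ z) ≤
      p.αt * ‖k‖ ^ 2 * (z ⬝ᵥ Ppar k *ᵥ z) + p.γt * ‖k‖ ^ 2 * (z ⬝ᵥ Pperp k *ᵥ z) := by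
    rw [← hsum, mul_add]
    gcongr
    · exact min_le_left _ _
    · exact min_le_right _ _
  -- Half of `κ` times this square accounts for the `κ / 2` part of the viscosity, the velocity
  -- coupling and the transverse part of `2 * κ * (z ⬝ᵥ z)`.
  have hslip := dotProduct_Pperp_nonneg k (‖k‖ • u - (2 : ℝ) • z)
  rw [dotProduct_Pperp_sub] at hslip
  have hvisc : 0 ≤ p.μ * ‖k‖ ^ 2 * (u ⬝ᵥ Pperp k *ᵥ u) :=
    mul_nonneg (mul_nonneg hp.μ_pos.le (sq_nonneg _)) (dotProduct_Pperp_nonneg k u)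
  have hzo : (o 0 ^ 2 + o 1 ^ 2) / p.lam ≤ z ⬝ᵥ z := by
    have h : z ⬝ᵥ z = (p.lam ^ (-1 / 2 : ℝ)) ^ 2 * (o 0 ^ 2 + o 1 ^ 2) + z 2 ^ 2 := by
      simp [hz, Params.JeqPow, mulVec_diagonal, dotProduct, Fin.sum_univ_three]
      ring
    rw [h, rpow_neg_half_sq hl, div_eq_inv_mul]
    linarith [sq_nonneg (z 2)]
  have hxa : a 0 ^ 2 + a 1 ^ 2 ≤ x ⬝ᵥ x := by
    have h : x ⬝ᵥ x = u ⬝ᵥ u + (o ⬝ᵥ o + (a 0 ^ 2 + a 1 ^ 2)) := by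
      simp [dotProduct, Fintype.sum_sum_type, hu, ho, ha, sq]
    have h1 : 0 ≤ u ⬝ᵥ u := Finset.sum_nonneg fun i _ => mul_self_nonneg _
    have h2 : 0 ≤ o ⬝ᵥ o := Finset.sum_nonneg fun i _ => mul_self_nonneg _
    linarith
  set e := m * ‖k‖ ^ 2 with he
  have he0 : 0 < e := by positivity
  -- Young's inequality, weighted so that the `o` term is exactly what rotational viscosity controls
  -- through `hzo` and `hstretch`.
  have hyoung : 2 * c * (o 0 * a 0 + o 1 * a 1) ≤
      e * ((o 0 ^ 2 + o 1 ^ 2) / p.lam) + c ^ 2 * p.lam / e * (a 0 ^ 2 + a 1 ^ 2) := by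
    have h : e * ((o 0 ^ 2 + o 1 ^ 2) / p.lam) + c ^ 2 * p.lam / e * (a 0 ^ 2 + a 1 ^ 2)
        - 2 * c * (o 0 * a 0 + o 1 * a 1) =
        ((e * o 0 - c * p.lam * a 0) ^ 2 + (e * o 1 - c * p.lam * a 1) ^ 2) / (e * p.lam) := by
      field_simp
      ring
    have h' : 0 ≤ ((e * o 0 - c * p.lam * a 0) ^ 2 + (e * o 1 - c * p.lam * a 1) ^ 2)
        / (e * p.lam) := by positivity
    linarith
  have h1 := mul_le_mul_of_nonneg_left hzo he0.le
  have h2 : c ^ 2 * p.lam / e * (a 0 ^ 2 + a 1 ^ 2) ≤ c ^ 2 * p.lam / e * (x ⬝ᵥ x) :=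
    mul_le_mul_of_nonneg_left hxa (by positivity)
  have h3 := mul_nonneg hp.κ_pos.le hslip
  have h4 := mul_nonneg hp.κ_pos.le hpar
  have h5 : p.κ * (z ⬝ᵥ z) = p.κ * (z ⬝ᵥ Ppar k *ᵥ z) + p.κ * (z ⬝ᵥ Pperp k *ᵥ z) := by
    rw [← hsum, mul_add]
  linarith

theorem re_le_of_isEigenvalue {p : Params} (hp : p.Oblong) {k : Wave} (hk : k ≠ 0) {w : ℂ}
    (hw : IsEigenvalue (M p k) w) :
    w.re ≤ p.coupling ^ 2 * p.lam / (min p.αt p.γt * ‖k‖ ^ 2) := by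
  rw [M_eq_toC_Mreal hp] at hw
  exact hw.re_le_of_forall_dotProduct_le (dotProduct_Mreal_le hp hk)

/-! ### Instability at zero wavenumber -/

theorem exists_quadratic_roots (b c : ℂ) :
    ∃ w₁ w₂ : ℂ, w₁ + w₂ = -b ∧ w₁ * w₂ = c := by
  obtain ⟨r, hr⟩ := IsAlgClosed.exists_pow_nat_eq (b ^ 2 - 4 * c) two_pos
  refine ⟨(-b + r) / 2, (-b - r) / 2, by ring, ?_⟩
  linear_combination (-1 / 4) * hr

/-- The dispersion relation at zero wavenumber has an unstable root. -/
theorem exists_unstable_root {a d θ : ℝ} (ha : 0 < a) (hd : 0 < d) (hθ : 0 < θ) (hθ1 : θ < 1) :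
    ∃ w : ℂ, 0 < w.re ∧
      (w + a + Complex.I * (θ * d)) * (w - Complex.I * d) = d ^ 2 * θ := by
  -- On expansion the terms `θ * d ^ 2` cancel, leaving a purely imaginary product of roots.
  obtain ⟨w₁, w₂, hs, hm⟩ := exists_quadratic_roots
    (a - Complex.I * ((1 - θ) * d)) (-Complex.I * (d * a))
  have hroot₁ : (w₁ + a + Complex.I * (θ * d)) * (w₁ - Complex.I * d) = d ^ 2 * θ := by
    linear_combination w₁ * hs - hm - (θ * d ^ 2 : ℂ) * Complex.I_sq
  have hroot₂ : (w₂ + a + Complex.I * (θ * d)) * (w₂ - Complex.I * d) = d ^ 2 * θ := by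
    linear_combination w₂ * hs - hm - (θ * d ^ 2 : ℂ) * Complex.I_sq
  by_contra! hcon
  have hx₁ : w₁.re ≤ 0 := not_lt.1 fun h => hcon w₁ h hroot₁
  have hx₂ : w₂.re ≤ 0 := not_lt.1 fun h => hcon w₂ h hroot₂
  have e1 : w₁.re + w₂.re = -a := by simpa using congrArg Complex.re hs
  have e2 : w₁.im + w₂.im = (1 - θ) * d := by simpa using congrArg Complex.im hs
  have e3 : w₁.re * w₂.re - w₁.im * w₂.im = 0 := by simpa using congrArg Complex.re hm
  have e4 : w₁.re * w₂.im + w₁.im * w₂.re = -(d * a) := by simpa using congrArg Complex.im hm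
  have hxx : 0 ≤ w₁.re * w₂.re := mul_nonneg_of_nonpos_of_nonpos hx₁ hx₂
  have hpos : 0 < (1 - θ) * d := mul_pos (by linarith) hd
  have hθd : 0 < θ * d := mul_pos hθ hd
  -- The imaginary parts have nonnegative product and positive sum, so both lie in `[0, (1 - θ) *
  -- d]`. With nonpositive real parts summing to `-a`, `e4` then gives `d * a ≤ a * (1 - θ) * d`,
  -- which is absurd.
  have hy₁ : 0 ≤ w₁.im := by
    by_contra! h
    nlinarith
  have hy₂ : 0 ≤ w₂.im := by
    by_contra! h
    nlinarith
  have f1 : 0 ≤ w₁.re * (w₂.im - (1 - θ) * d) :=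
    mul_nonneg_of_nonpos_of_nonpos hx₁ (by linarith)
  have f2 : 0 ≤ w₂.re * (w₁.im - (1 - θ) * d) :=
    mul_nonneg_of_nonpos_of_nonpos hx₂ (by linarith)
  have f3 : w₁.re = -a - w₂.re := by linarith
  rw [f3] at f1 e4
  have f4 := mul_pos ha hθd
  nlinarith

theorem coupling_pos {p : Params} (hp : p.Oblong) : 0 < p.coupling :=
  mul_pos (mul_pos (d_pos hp) (Real.sqrt_pos.2 (sub_pos.2 hp.ν_lt_lam)))
    (Real.rpow_pos_of_pos (lam_pos hp) _)

theorem coupling_sq {p : Params} (hp : p.Oblong) :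
    p.coupling ^ 2 = p.d ^ 2 * (1 - p.ν / p.lam) := by
  have hl := lam_pos hp
  rw [Params.coupling, mul_pow, mul_pow, rpow_neg_half_sq hl,
    Real.sq_sqrt (sub_pos.2 hp.ν_lt_lam).le]
  field_simp

theorem exists_unstable_eigenvalue_zero {p : Params} (hp : p.Oblong) :
    ∃ w : ℂ, 0 < w.re ∧ IsEigenvalue (M p 0) w := by
  have hl := lam_pos hp
  have hc := coupling_pos hp
  obtain ⟨w, hw, hroot⟩ := exists_unstable_root (a := 2 * p.κ * p.lam⁻¹) (d := p.d)
    (θ := 1 - p.ν / p.lam) (mul_pos (mul_pos two_pos hp.κ_pos) (inv_pos.2 hl)) (d_pos hp)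
    (sub_pos.2 ((div_lt_one hl).2 hp.ν_lt_lam)) (sub_lt_self _ (div_pos hp.ν_pos hl))
  refine ⟨w, hw, ?_⟩
  rw [M_eq_toC_Mreal hp]
  have hcc : (p.coupling : ℂ) ^ 2 = (p.d : ℂ) ^ 2 * (1 - p.ν / p.lam : ℝ) := by
    exact_mod_cast congrArg Complex.ofReal (coupling_sq hp)
  have hq : ((p.lam ^ (-1 / 2 : ℝ) : ℝ) : ℂ) ^ 2 = (p.lam⁻¹ : ℝ) := by
    exact_mod_cast congrArg Complex.ofReal (rpow_neg_half_sq hl)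
  rw [← hcc] at hroot
  set y : ℂ := w - Complex.I * p.d with hy
  -- The vector `(1, -i)` is an eigenvector of `R22` for `i`. On such polarizations both rotations
  -- are scalars, and the microinertia rows force the ratio `y : p.coupling`.
  refine IsEigenvalue.of_mulVec (v := Sum.elim 0 (Sum.elim ![y, -Complex.I * y, 0]
    ![(p.coupling : ℂ), -Complex.I * p.coupling])) ?_ ?_
  · intro h
    have := congrFun h (Sum.inr (Sum.inr 0))
    simp [hc.ne'] at this
  · set q : ℝ := p.lam ^ (-1 / 2 : ℝ) with hqdef
    push_cast at hroot hq
    ext (i | i | i) <;> fin_cases i <;>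
      simp [Mreal, toC, Params.JeqPow, Matrix.mulVec, dotProduct, Fintype.sum_sum_type,
        Fin.sum_univ_three, Fin.sum_univ_two, Pperp, Ppar, I32, R33, R22, ← hqdef]
    · linear_combination -hroot - 2 * p.κ * y * hq
    · linear_combination Complex.I * (hroot + 2 * p.κ * y * hq)
        - p.d * (1 - p.ν / p.lam) * y * Complex.I_sq
    · linear_combination p.coupling * hy
    · linear_combination -Complex.I * p.coupling * hy + p.coupling * p.d * Complex.I_sq

/-! ### Finiteness of the unstable modes -/

theorem finite_latt_norm_le (R : ℝ) : {k : Fin 3 → ℤ | ‖latt k‖ ^ 2 ≤ R}.Finite := by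
  refine (Set.finite_Icc (fun _ => -⌈R⌉ : Fin 3 → ℤ) (fun _ => ⌈R⌉)).subset fun k hk => ?_
  rw [Set.mem_ofPred_eq, EuclideanSpace.real_norm_sq_eq] at hk
  have h : ∀ i, |k i| ≤ ⌈R⌉ := fun i => by
    have h1 : (k i : ℝ) ^ 2 ≤ R :=
      (Finset.single_le_sum (f := fun i => (latt k i) ^ 2) (fun j _ => sq_nonneg _)
        (Finset.mem_univ i)).trans hk
    have h2 : k i ^ 2 ≤ ⌈R⌉ := by exact_mod_cast h1.trans (Int.le_ceil R)
    rw [← sq_abs] at h2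
    nlinarith [Int.le_self_sq (|k i|)]
  exact ⟨fun i => (abs_le.1 (h i)).1, fun i => (abs_le.1 (h i)).2⟩

theorem latt_zero : latt 0 = 0 := by
  ext i
  simp [latt]

theorem finite_unstable_modes {p : Params} (hp : p.Oblong) {ε : ℝ} (hε : 0 < ε) :
    {q : (Fin 3 → ℤ) × ℂ | IsEigenvalue (M p (latt q.1)) q.2 ∧ ε ≤ q.2.re}.Finite := by
  have hm0 : 0 < min p.αt p.γt := lt_min hp.αt_pos hp.γt_pos
  set C := p.coupling ^ 2 * p.lam / min p.αt p.γt with hC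
  have hC0 : 0 ≤ C := by have := lam_pos hp; positivity
  refine ((finite_latt_norm_le (C / ε)).biUnion (t := fun k =>
    Set.image (fun w => (k, w)) {w | IsEigenvalue (M p (latt k)) w})
    fun k _ => Set.Finite.image _ ?_).subset ?_
  · exact Module.End.finite_hasEigenvalue (Matrix.toLin' (M p (latt k)))
  · rintro ⟨k, w⟩ ⟨hw, hεw⟩
    simp only [Set.mem_iUnion]
    refine ⟨k, ?_, w, hw, rfl⟩
    -- The energy bound says nothing at zero, but the zero mode lies in the ball anyway.
    by_cases hk : latt k = 0
    · simp only [Set.mem_ofPred_eq, hk, norm_zero]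
      rw [zero_pow two_ne_zero]
      positivity
    · have h := hεw.trans (re_le_of_isEigenvalue hp hk hw)
      have hK : 0 < ‖latt k‖ ^ 2 := by positivity
      rw [← div_div, ← hC, le_div_iff₀ hK] at h
      rw [Set.mem_ofPred_eq, le_div_iff₀ hε]
      linarith

end

end Micropolar

theorem mainTheorem5 (p : Micropolar.Params) (hp : p.Oblong) :
    ∃ (kstar : Fin 3 → ℤ) (wstar : ℂ), 0 < wstar.re ∧
      Micropolar.IsEigenvalue (Micropolar.M p (Micropolar.latt kstar)) wstar ∧
      ∀ (k : Fin 3 → ℤ) (w : ℂ),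
        Micropolar.IsEigenvalue (Micropolar.M p (Micropolar.latt k)) w → w.re ≤ wstar.re := by
  obtain ⟨w₀, hw₀, he₀⟩ := Micropolar.exists_unstable_eigenvalue_zero hp
  rw [← Micropolar.latt_zero] at he₀
  obtain ⟨⟨k, w⟩, ⟨he, hw⟩, hmax⟩ := Set.exists_max_image _
    (fun q : (Fin 3 → ℤ) × ℂ => q.2.re) (Micropolar.finite_unstable_modes hp hw₀)
    ⟨(0, w₀), he₀, le_rfl⟩
  refine ⟨k, w, hw₀.trans_le hw, he, fun k' w' he' => ?_⟩
  rcases le_total w₀.re w'.re with h | h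
  · exact hmax (k', w') ⟨he', h⟩
  · exact h.trans hw
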